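/- Let $D^t\subseteq\mathbb R^{n}$ be open and let $D^{z}\subseteq\mathbb R^{s}$ be open and symmetric, i.e. $z\in D^z$ implies $\operatorname{diag}(\sigma)z\in D^z$ for every $\sigma\in\{-1,0,1\}^s$. Let $f\in C^d(D^t,\mathbb R)$, $c_{\mathcal E}\in C^d(D^t\times D^z,\mathbb R^{m_1})$, $c_{\mathcal I}\in C^d(D^t\times D^z,\mathbb R^{m_2})$, $c_{\mathcal Z}\in C^d(D^t\times D^z,\mathbb R^{s})$ with $d\ge 2$, where the Jacobian $\partial_2c_{\mathcal Z}(t,|z|)$ is strictly lower triangular for all $t\in D^t$, $z\in D^z$ ($|\cdot|$ is taken componentwise). Consider the abs-normal NLP $$\min_{t,z}\ f(t)\quad\text{s.t.}\quad c_{\mathcal E}(t,|z|)=0,\quad c_{\mathcal I}(t,|z|)\ge 0,\quad c_{\mathcal Z}(t,|z|)-z=0 .\tag{I-NLP}$$ Let $(t^*,z^*)$ be feasible. Put $\sigma=\operatorname{sign}(z^*)\in\{-1,0,1\}^s$, $\Sigma=\operatorname{diag}(\sigma)$, $\alpha=\{i: z^*_i=0\}$, $\alpha^c=\{1,\dots,s\}\setminus\alpha$,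 $\mathcal A=\{i:(c_{\mathcal I})_i(t^*,|z^*|)=0\}$, and let $P_{\alpha^c}$ be the matrix that selects the components with index in $\alpha^c$. All derivatives of $c_{\mathcal E},c_{\mathcal I},c_{\mathcal Z}$ below are evaluated at $(t^*,|z^*|)$. Put $\partial_tz=(I-\partial_2c_{\mathcal Z}\Sigma)^{-1}\partial_1c_{\mathcal Z}$ and $$J_{abs}=\begin{bmatrix}\partial_1c_{\mathcal E}+\partial_2c_{\mathcal E}\,\Sigma\,\partial_tz\\ [e_i^T(\partial_1c_{\mathcal I}+\partial_2c_{\mathcal I}\,\Sigma\,\partial_tz)]_{i\in\mathcal A}\\ [e_i^T\partial_tz]_{i\in\alpha}\end{bmatrix}.$$ Assume: 1. (Kink stationarity.) There is $\lambda=(\lambda_{\mathcal E},\lambda_{\mathcal I},\lambda_{\mathcal Z})$ such that $f'(t^*)+\lambda_{\mathcal E}^T\partial_1c_{\mathcal E}-\lambda_{\mathcal I}^T\partial_1c_{\mathcal I}+\lambda_{\mathcal Z}^T\partial_1c_{\mathcal Z}=0$, $\lambda_{\mathcal I}\ge0$, $\lambda_{\mathcal I}^Tc_{\mathcal I}(t^*,|z^*|)=0$,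 and the vector $g=\lambda_{\mathcal E}^T\partial_2c_{\mathcal E}-\lambda_{\mathcal I}^T\partial_2c_{\mathcal I}+\lambda_{\mathcal Z}^T\partial_2c_{\mathcal Z}$ satisfies $g_i\ge|(\lambda_{\mathcal Z})_i|$ for $i\in\alpha$ and $g_i=(\lambda_{\mathcal Z})_i\sigma_i$ for $i\notin\alpha$. 2. (Strict complementarity.) $(\lambda_{\mathcal I})_i>0$ for all $i\in\mathcal A$. 3. (Strict normal growth.) $g_i>|(\lambda_{\mathcal Z})_i|$ for all $i\in\alpha$. 4. (LIKQ.) $J_{abs}$ has full row rank $m_1+|\mathcal A|+|\alpha|$. 5. (Reduced Hessian.) $U_{abs}^TH_{abs}U_{abs}$ is positive definite, where $U_{abs}=\begin{bmatrix}U\\ [e_i^T\Sigma\,\partial_tz\,U]_{i\notin\alpha}\end{bmatrix}$ for a matrix $U$ whose columns span $\ker J_{abs}$, and $$H_{abs}=\begin{bmatrix}I&0\\0&P_{\alpha^c}\end{bmatrix}\begin{bmatrix}\partial_{11}\mathcal L&\partial_{12}\mathcal L\\ \partial_{21}\mathcal L&\partial_{22}\mathcal L\end{bmatrix}\begin{bmatrix}I&0\\0&P_{\alpha^c}^T\end{bmatrix}$$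 with the second derivatives evaluated at $(t^*,|z^*|)$ of the Lagrangian $\mathcal L(t,w)=f(t)+\lambda_{\mathcal E}^Tc_{\mathcal E}(t,w)-\lambda_{\mathcal I}^Tc_{\mathcal I}(t,w)+\lambda_{\mathcal Z}^T\bigl(c_{\mathcal Z}(t,w)-P_{\alpha^c}^TP_{\alpha^c}\Sigma w\bigr)$. Then $(t^*,z^*)$ is a strict local minimizer of (I-NLP): every feasible $(t,z)\ne(t^*,z^*)$ sufficiently close to $(t^*,z^*)$ satisfies $f(t)>f(t^*)$. -/

import Mathlib

open Matrix Topology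

noncomputable section

namespace AbsNormal

/-- Componentwise modulus `|z|`. -/
def cabs {s : ℕ} (z : Fin s → ℝ) : Fin s → ℝ := fun i => |z i|

/-- The signature matrix `Σ = diag(sign z)`, with entries in `{-1, 0, 1}`. -/
def sigMat {s : ℕ} (z : Fin s → ℝ) : Matrix (Fin s) (Fin s) ℝ :=
  Matrix.diagonal fun i => ((SignType.sign (z i) : SignType) : ℝ)

/-- Jacobian of `F` with respect to its first argument, at the point `(t, w)`. -/
def jac₁ {n s m : ℕ} (F : (Fin n → ℝ) × (Fin s → ℝ) → (Fin m → ℝ))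
    (t : Fin n → ℝ) (w : Fin s → ℝ) : Matrix (Fin m) (Fin n) ℝ :=
  LinearMap.toMatrix' (fderiv ℝ (fun x => F (x, w)) t : (Fin n → ℝ) →ₗ[ℝ] (Fin m → ℝ))

/-- Jacobian of `F` with respect to its second argument, at the point `(t, w)`. -/
def jac₂ {n s m : ℕ} (F : (Fin n → ℝ) × (Fin s → ℝ) → (Fin m → ℝ))
    (t : Fin n → ℝ) (w : Fin s → ℝ) : Matrix (Fin m) (Fin s) ℝ :=
  LinearMap.toMatrix' (fderiv ℝ (fun y => F (t, y)) w : (Fin s → ℝ) →ₗ[ℝ] (Fin m → ℝ))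

/-- The gradient of a scalar function, as a coordinate vector. -/
def grad {n : ℕ} (f : (Fin n → ℝ) → ℝ) (t : Fin n → ℝ) : Fin n → ℝ :=
  fun j => fderiv ℝ f t (Pi.single j 1)

/-- The block Hessian `[∂₁₁ L, ∂₁₂ L; ∂₂₁ L, ∂₂₂ L]` of a scalar function `L(t, w)`. -/
def blockHessian {n s : ℕ} (L : (Fin n → ℝ) × (Fin s → ℝ) → ℝ)
    (t : Fin n → ℝ) (w : Fin s → ℝ) : Matrix (Fin n ⊕ Fin s) (Fin n ⊕ Fin s) ℝ :=
  let H := fderiv ℝ (fderiv ℝ L) (t, w)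
  Matrix.fromBlocks
    (Matrix.of fun i j => H (Pi.single i 1, 0) (Pi.single j 1, 0))
    (Matrix.of fun i j => H (Pi.single i 1, 0) (0, Pi.single j 1))
    (Matrix.of fun i j => H (0, Pi.single i 1) (Pi.single j 1, 0))
    (Matrix.of fun i j => H (0, Pi.single i 1) (0, Pi.single j 1))

/-- The matrix `P_S` selecting the components with index in `S`. -/
def selMat {s : ℕ} (S : Finset (Fin s)) : Matrix S (Fin s) ℝ :=
  (1 : Matrix (Fin s) (Fin s) ℝ).submatrix Subtype.val id

/-- The data of an abs-normal NLP of smoothness class `C^d`: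
minimize `f(t)` over `(t, z)` subject to
`cE(t, |z|) = 0`, `cI(t, |z|) ≥ 0`, `cZ(t, |z|) - z = 0`. -/
structure NLP (d : ℕ∞) (n m₁ m₂ s : ℕ) where
  /-- the domain of `t` -/
  Dt : Set (Fin n → ℝ)
  /-- the domain of the second argument `|z|` -/
  Dz : Set (Fin s → ℝ)
  f : (Fin n → ℝ) → ℝ
  cE : (Fin n → ℝ) × (Fin s → ℝ) → (Fin m₁ → ℝ)
  cI : (Fin n → ℝ) × (Fin s → ℝ) → (Fin m₂ → ℝ)
  cZ : (Fin n → ℝ) × (Fin s → ℝ) → (Fin s → ℝ)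
  one_le_d : 1 ≤ d
  isOpen_Dt : IsOpen Dt
  isOpen_Dz : IsOpen Dz
  symmetric_Dz : ∀ z ∈ Dz, ∀ σ : Fin s → SignType,
    Matrix.diagonal (fun i => ((σ i : SignType) : ℝ)) *ᵥ z ∈ Dz
  contDiffOn_f : ContDiffOn ℝ d f Dt
  contDiffOn_cE : ContDiffOn ℝ d cE (Dt ×ˢ Dz)
  contDiffOn_cI : ContDiffOn ℝ d cI (Dt ×ˢ Dz)
  contDiffOn_cZ : ContDiffOn ℝ d cZ (Dt ×ˢ Dz)
  /-- `∂₂ cZ(t, |z|)` is strictly lower triangular. -/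
  strictLower : ∀ t ∈ Dt, ∀ z ∈ Dz, ∀ i j : Fin s, i ≤ j → jac₂ cZ t (cabs z) i j = 0

/-- A vector of Lagrange multipliers `λ = (λ_E, λ_I, λ_Z)`. -/
structure Multiplier (m₁ m₂ s : ℕ) where
  E : Fin m₁ → ℝ
  I : Fin m₂ → ℝ
  Z : Fin s → ℝ

/-- The active switching set `α = {i | z i = 0}`. -/
def activeSwitch {s : ℕ} (z : Fin s → ℝ) : Finset (Fin s) :=
  Finset.univ.filter fun i => z i = 0

namespace NLP

variable {d : ℕ∞} {n m₁ m₂ s : ℕ} (P : NLP d n m₁ m₂ s)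

/-- The feasible set. -/
def feasible : Set ((Fin n → ℝ) × (Fin s → ℝ)) :=
  {p | p.1 ∈ P.Dt ∧ cabs p.2 ∈ P.Dz ∧
    P.cE (p.1, cabs p.2) = 0 ∧
    (∀ i, 0 ≤ P.cI (p.1, cabs p.2) i) ∧
    P.cZ (p.1, cabs p.2) - p.2 = 0}

/-- The active inequality set `A = {i | c_i(t, |z|) = 0}`. -/
def activeIneq (t : Fin n → ℝ) (z : Fin s → ℝ) : Finset (Fin m₂) :=
  Finset.univ.filter fun i => P.cI (t, cabs z) i = 0

/-- The Jacobian `∂_t z = (I - ∂₂ cZ Σ)⁻¹ ∂₁ cZ` of the switching variables, for the fixed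
signature `Σ` of `z`. -/
def jacz (t : Fin n → ℝ) (z : Fin s → ℝ) : Matrix (Fin s) (Fin n) ℝ :=
  (1 - jac₂ P.cZ t (cabs z) * sigMat z)⁻¹ * jac₁ P.cZ t (cabs z)

/-- The equality-constraints Jacobian. -/
def JE (t : Fin n → ℝ) (z : Fin s → ℝ) : Matrix (Fin m₁) (Fin n) ℝ :=
  jac₁ P.cE t (cabs z) + jac₂ P.cE t (cabs z) * sigMat z * P.jacz t z

/-- The active inequality Jacobian. -/
def JA (t : Fin n → ℝ) (z : Fin s → ℝ) : Matrix (P.activeIneq t z) (Fin n) ℝ :=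
  (jac₁ P.cI t (cabs z) + jac₂ P.cI t (cabs z) * sigMat z * P.jacz t z).submatrix
    Subtype.val id

/-- The active switching Jacobian. -/
def Jα (t : Fin n → ℝ) (z : Fin s → ℝ) : Matrix (activeSwitch z) (Fin n) ℝ :=
  (P.jacz t z).submatrix Subtype.val id

/-- The stacked Jacobian `J_abs = [J_E; J_A; J_α]`. -/
def Jabs (t : Fin n → ℝ) (z : Fin s → ℝ) :
    Matrix (Fin m₁ ⊕ (P.activeIneq t z ⊕ activeSwitch z)) (Fin n) ℝ :=
  Matrix.fromRows (P.JE t z) (Matrix.fromRows (P.JA t z) (P.Jα t z))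

/-- Linear independence kink qualification: `J_abs` has full row rank. -/
def LIKQ (t : Fin n → ℝ) (z : Fin s → ℝ) : Prop :=
  (P.Jabs t z).rank = m₁ + (P.activeIneq t z).card + (activeSwitch z).card

/-- The row vector `λ_Eᵀ ∂₂ cE - λ_Iᵀ ∂₂ cI + λ_Zᵀ ∂₂ cZ` at `(t, |z|)`. -/
def normalVec (t : Fin n → ℝ) (z : Fin s → ℝ) (l : Multiplier m₁ m₂ s) : Fin s → ℝ :=
  l.E ᵥ* jac₂ P.cE t (cabs z) - l.I ᵥ* jac₂ P.cI t (cabs z) + l.Z ᵥ* jac₂ P.cZ t (cabs z)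

/-- `(t, z)` is a kink stationary (feasible) point with multiplier vector `l`. -/
structure IsKinkStationary (t : Fin n → ℝ) (z : Fin s → ℝ) (l : Multiplier m₁ m₂ s) :
    Prop where
  feas : (t, z) ∈ P.feasible
  stat : grad P.f t + l.E ᵥ* jac₁ P.cE t (cabs z) - l.I ᵥ* jac₁ P.cI t (cabs z)
    + l.Z ᵥ* jac₁ P.cZ t (cabs z) = 0
  active : ∀ i ∈ activeSwitch z, |l.Z i| ≤ P.normalVec t z l i
  inactive : ∀ i ∉ activeSwitch z,
    P.normalVec t z l i = l.Z i * ((SignType.sign (z i) : SignType) : ℝ)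
  nonneg : ∀ i, 0 ≤ l.I i
  compl : l.I ⬝ᵥ P.cI (t, cabs z) = 0

/-- Strict complementarity of the inequality multipliers. -/
def StrictComplementarity (t : Fin n → ℝ) (z : Fin s → ℝ) (l : Multiplier m₁ m₂ s) : Prop :=
  ∀ i ∈ P.activeIneq t z, 0 < l.I i

/-- Strict normal growth. -/
def StrictNormalGrowth (t : Fin n → ℝ) (z : Fin s → ℝ) (l : Multiplier m₁ m₂ s) : Prop :=
  ∀ i ∈ activeSwitch z, |l.Z i| < P.normalVec t z l i

/-- The Lagrangian
`f(t) + λ_Eᵀ cE(t,w) - λ_Iᵀ cI(t,w) + λ_Zᵀ (cZ(t,w) - P_{αᶜ}ᵀ P_{αᶜ} Σ w)` as a function of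
`(t, w)`, where `w` stands for `|z|` and `α`, `Σ` are fixed, belonging to the reference
point `z`. -/
def lagrangian (z : Fin s → ℝ) (l : Multiplier m₁ m₂ s) :
    (Fin n → ℝ) × (Fin s → ℝ) → ℝ :=
  fun p => P.f p.1 + l.E ⬝ᵥ P.cE p - l.I ⬝ᵥ P.cI p
    + l.Z ⬝ᵥ (P.cZ p -
      ((selMat (activeSwitch z)ᶜ)ᵀ * selMat (activeSwitch z)ᶜ * sigMat z) *ᵥ p.2)

/-- `H_abs = diag(I, P_{αᶜ}) [∂ᵢⱼ L] diag(I, P_{αᶜ}ᵀ)`, evaluated at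
`(t, |z|)`; below, `Q = diag(I, P_{αᶜ})`. -/
def Habs (t : Fin n → ℝ) (z : Fin s → ℝ) (l : Multiplier m₁ m₂ s) :
    Matrix (Fin n ⊕ ((activeSwitch z)ᶜ : Finset (Fin s)))
      (Fin n ⊕ ((activeSwitch z)ᶜ : Finset (Fin s))) ℝ :=
  let Q : Matrix (Fin n ⊕ ((activeSwitch z)ᶜ : Finset (Fin s))) (Fin n ⊕ Fin s) ℝ :=
    Matrix.fromBlocks 1 0 0 (selMat (activeSwitch z)ᶜ)
  Q * blockHessian (P.lagrangian z l) t (cabs z) * Qᵀ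

/-- `U_abs = [U; [e_iᵀ Σ ∂_t z U]_{i ∉ α}]`. -/
def Uabs {k : ℕ} (t : Fin n → ℝ) (z : Fin s → ℝ) (U : Matrix (Fin n) (Fin k) ℝ) :
    Matrix (Fin n ⊕ ((activeSwitch z)ᶜ : Finset (Fin s))) (Fin k) ℝ :=
  Matrix.fromRows U ((sigMat z * P.jacz t z * U).submatrix Subtype.val id)

/-- `(t, z)` is a strict local minimizer: it is feasible, and every other feasible point
sufficiently close to it has a strictly larger objective value. -/
def IsStrictLocalMinimizer (t : Fin n → ℝ) (z : Fin s → ℝ) : Prop :=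
  (t, z) ∈ P.feasible ∧
    ∀ᶠ p in 𝓝 (t, z), p ∈ P.feasible → p ≠ (t, z) → P.f t < P.f p.1

end NLP

/-- The columns of `U` span the nullspace of `J`. -/
def SpansNullspace {ι : Type*} {n k : ℕ} (U : Matrix (Fin n) (Fin k) ℝ)
    (J : Matrix ι (Fin n) ℝ) : Prop :=
  Submodule.span ℝ (Set.range U.col) = LinearMap.ker J.mulVecLin

end AbsNormal

end

/-! Regard the data as smooth functions of (t, w), the only kink being w = |z|. Suppose feasible
points other than the reference point accumulate there without increasing f. Close enough, the signs
of the inactive switching variables are frozen, and kink stationarity leaves in the derivative of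
the Lagrangian only the normal terms of active switches. `objective_sub_eq` therefore splits the
increase of f into three pieces: the second-order remainder of the Lagrangian, the sum of the
(λ_I)_j (c_I)_j, and the sum over active i of g_i |z_i| - (λ_Z)_i z_i. The last two are nonnegative,
while the remainder is quadratic in the step.

Divide by the step length in (t, w): every nonnegative term must tend to 0. In a limit direction,
strict normal growth then kills the active switching components, and strict complementarity kills
the linearized active inequalities. Dividing by the squared length shows that the curvature along
this direction is nonpositive (`exists_critical_direction`). Its t-part τ lies in ker J_abs and,
through ∂_t z, determines the whole direction, so τ ≠ 0. This contradicts the positive definite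
reduced Hessian (`hessian_pos`). -/

namespace AbsNormal

open Filter Asymptotics

/-! ### Second-order expansions -/

/-- Second-order Taylor expansion of a scalar function with the Peano form of the remainder. -/
theorem taylor_two_isLittleO {E : Type*} [NormedAddCommGroup E] [NormedSpace ℝ E]
    {f : E → ℝ} {x : E} (hf : ContDiffAt ℝ 2 f x) :
    (fun h => f (x + h) - f x - fderiv ℝ f x h - (1 / 2) * fderiv ℝ (fderiv ℝ f) x h h)
      =o[𝓝 0] fun h => ‖h‖ ^ 2 := by
  set B := fderiv ℝ (fderiv ℝ f) x with hB
  have hsymm : ∀ v w, B v w = B w v := hf.isSymmSndFDerivAt (by simp)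
  have hd : HasFDerivAt (fderiv ℝ f) B x :=
    ((hf.fderiv_right (m := 1) (by norm_num)).differentiableAt (by norm_num)).hasFDerivAt
  have hdiff : ∀ᶠ h in 𝓝 (0 : E), DifferentiableAt ℝ f (x + h) := by
    have h1 : ∀ᶠ y in 𝓝 x, DifferentiableAt ℝ f y :=
      (hf.eventually (by simp)).mono fun y hy => hy.differentiableAt (by norm_num)
    have h2 : Tendsto (fun h : E => x + h) (𝓝 0) (𝓝 x) := by
      simpa using (continuous_const_add x).tendsto 0
    exact h2.eventually h1
  rw [isLittleO_iff]
  intro c hc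
  have hlin := (hasFDerivAt_iff_isLittleO_nhds_zero.1 hd).def hc
  obtain ⟨r, hr, hball⟩ := Metric.eventually_nhds_iff_ball.1 (hdiff.and hlin)
  refine Metric.eventually_nhds_iff_ball.2 ⟨r, hr, fun h hh => ?_⟩
  have hh' : ‖h‖ < r := by simpa using hh
  have hsub : ∀ y ∈ Metric.closedBall (0 : E) ‖h‖, y ∈ Metric.ball (0 : E) r := fun y hy =>
    Metric.closedBall_subset_ball hh' hy
  -- Mean value inequality on the ball of radius ‖h‖: there the derivative of the remainder has norm
  -- at most c‖h‖, which yields the bound c‖h‖².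
  have key := (convex_closedBall (0 : E) ‖h‖).norm_image_sub_le_of_norm_hasFDerivWithin_le
    (𝕜 := ℝ)
    (f := fun h => f (x + h) - f x - fderiv ℝ f x h - (1 / 2) * B h h)
    (f' := fun y => fderiv ℝ f (x + y) - fderiv ℝ f x - B y) (C := c * ‖h‖)
    (x := 0) (y := h) ?_ ?_ (by simp) (by simp)
  · simpa [pow_two, mul_assoc] using key
  · intro y hy
    have h1 : HasFDerivAt (fun h => f (x + h)) (fderiv ℝ f (x + y)) y :=
      (hasFDerivAt_comp_add_left x).2 (hball y (hsub y hy)).1.hasFDerivAt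
    -- The product rule gives half of B y v + B v y; symmetry of the second derivative merges the
    -- two terms.
    have h2 : HasFDerivAt (fun h : E => (1 / 2 : ℝ) * B h h) (B y) y := by
      have := ((B.hasFDerivAt (x := y)).clm_apply (hasFDerivAt_id y)).const_mul (1 / 2 : ℝ)
      refine this.congr_fderiv ?_
      ext v
      simp [hsymm v y, ← two_mul]
    exact (((h1.sub_const (f x)).sub (fderiv ℝ f x).hasFDerivAt).sub h2).hasFDerivWithinAt
  · intro y hy
    refine ((hball y (hsub y hy)).2).trans ?_
    have : ‖y‖ ≤ ‖h‖ := by simpa using hy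
    gcongr

/-- The scaled second-order remainder converges to half the Hessian at the limit direction. -/
theorem tendsto_second_order {E ι : Type*} [NormedAddCommGroup E] [NormedSpace ℝ E]
    {f : E → ℝ} {x v : E} (hf : ContDiffAt ℝ 2 f x) {l : Filter ι} {c : ι → ℝ} {δ : ι → E}
    (hδ : Tendsto δ l (𝓝 0)) (hv : Tendsto (fun i => c i • δ i) l (𝓝 v)) :
    Tendsto (fun i => c i ^ 2 * (f (x + δ i) - f x - fderiv ℝ f x (δ i))) l
      (𝓝 ((1 / 2) * fderiv ℝ (fderiv ℝ f) x v v)) := by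
  set B := fderiv ℝ (fderiv ℝ f) x with hB
  have h1 : (fun i => c i ^ 2 * (f (x + δ i) - f x - fderiv ℝ f x (δ i) - 1 / 2 * B (δ i) (δ i)))
      =o[l] (fun _ => (1 : ℝ)) := by
    have ha := (isBigO_refl (fun i => c i ^ 2) l).mul_isLittleO
      ((taylor_two_isLittleO hf).comp_tendsto hδ)
    refine ha.trans_isBigO ?_
    -- Convergence of c • δ bounds c²‖δ‖², so the Peano remainder stays negligible after scaling.
    have hb : Tendsto (fun i => c i ^ 2 * ‖δ i‖ ^ 2) l (𝓝 (‖v‖ ^ 2)) := by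
      refine (hv.norm.pow 2).congr fun i => ?_
      rw [norm_smul, mul_pow, Real.norm_eq_abs, sq_abs]
    exact hb.isBigO_one ℝ
  have h2 : Tendsto (fun i => (1 / 2) * B (c i • δ i) (c i • δ i)) l (𝓝 ((1 / 2) * B v v)) := by
    have hc : Continuous fun h : E => (1 / 2 : ℝ) * B h h := by fun_prop
    exact (hc.tendsto v).comp hv
  have h3 := ((isLittleO_one_iff ℝ).1 h1).add h2
  rw [zero_add] at h3
  refine h3.congr fun i => ?_
  simp only [map_smul, _root_.smul_apply, smul_eq_mul]
  ring

/-! ### Derivatives in coordinates, selection and signature matrices -/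

/-- The derivative acts through the two partial Jacobians. -/
theorem jac_mulVec_add {n s m : ℕ} {F : (Fin n → ℝ) × (Fin s → ℝ) → (Fin m → ℝ)}
    {t : Fin n → ℝ} {w : Fin s → ℝ} (hF : DifferentiableAt ℝ F (t, w))
    (v : (Fin n → ℝ) × (Fin s → ℝ)) :
    fderiv ℝ F (t, w) v = jac₁ F t w *ᵥ v.1 + jac₂ F t w *ᵥ v.2 := by
  have h1 : HasFDerivAt (fun x => F (x, w)) ((fderiv ℝ F (t, w)).comp
      (ContinuousLinearMap.inl ℝ _ _)) t :=
    hF.hasFDerivAt.comp t (hasFDerivAt_prodMk_left t w)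
  have h2 : HasFDerivAt (fun y => F (t, y)) ((fderiv ℝ F (t, w)).comp
      (ContinuousLinearMap.inr ℝ _ _)) w :=
    hF.hasFDerivAt.comp w (hasFDerivAt_prodMk_right t w)
  rw [jac₁, jac₂, h1.fderiv, h2.fderiv, LinearMap.toMatrix'_mulVec, LinearMap.toMatrix'_mulVec]
  simp [← map_add]

theorem clm_apply_eq_sum_prod {n s : ℕ} (φ : (Fin n → ℝ) × (Fin s → ℝ) →L[ℝ] ℝ)
    (v : (Fin n → ℝ) × (Fin s → ℝ)) :
    φ v = ∑ i, v.1 i * φ (Pi.single i 1, 0) + ∑ i, v.2 i * φ (0, Pi.single i 1) := by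
  have h1 := LinearMap.pi_apply_eq_sum_univ
    ((φ.comp (ContinuousLinearMap.inl ℝ (Fin n → ℝ) (Fin s → ℝ))) : (Fin n → ℝ) →ₗ[ℝ] ℝ) v.1
  have h2 := LinearMap.pi_apply_eq_sum_univ
    ((φ.comp (ContinuousLinearMap.inr ℝ (Fin n → ℝ) (Fin s → ℝ))) : (Fin s → ℝ) →ₗ[ℝ] ℝ) v.2
  have h3 : v = (v.1, 0) + (0, v.2) := by simp
  have e1 : ∀ (m : ℕ) (i : Fin m), (fun j => if i = j then (1 : ℝ) else 0) = Pi.single i 1 := by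
    intro m i
    ext j
    simp [Pi.single_apply, eq_comm]
  simp only [e1, ContinuousLinearMap.coe_coe, ContinuousLinearMap.comp_apply,
    ContinuousLinearMap.inl_apply, ContinuousLinearMap.inr_apply, smul_eq_mul] at h1 h2
  rw [← h1, ← h2, ← map_add, ← h3]

/-- The quadratic form of the block Hessian is the second derivative. -/
theorem dotProduct_blockHessian_mulVec {n s : ℕ} (L : (Fin n → ℝ) × (Fin s → ℝ) → ℝ)
    (t : Fin n → ℝ) (w : Fin s → ℝ) (a : Fin n → ℝ) (b : Fin s → ℝ) :
    Sum.elim a b ⬝ᵥ (blockHessian L t w *ᵥ Sum.elim a b)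
      = fderiv ℝ (fderiv ℝ L) (t, w) (a, b) (a, b) := by
  set H := fderiv ℝ (fderiv ℝ L) (t, w) with hH
  have e1 : ∀ u, H (a, b) u = ∑ i, a i * H (Pi.single i 1, 0) u
      + ∑ i, b i * H (0, Pi.single i 1) u := fun u =>
    clm_apply_eq_sum_prod (H.flip u) (a, b)
  rw [e1, Finset.sum_congr rfl fun i _ => by rw [clm_apply_eq_sum_prod (H _) (a, b)],
    Finset.sum_congr (f := fun i => b i * H (0, Pi.single i 1) (a, b)) rfl
      fun i _ => by rw [clm_apply_eq_sum_prod (H _) (a, b)]]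
  simp only [blockHessian, dotProduct, mulVec, Fintype.sum_sum_type, Sum.elim_inl, Sum.elim_inr,
    fromBlocks_apply₁₁, fromBlocks_apply₁₂, fromBlocks_apply₂₁, fromBlocks_apply₂₂, of_apply]
  simp only [mul_comm, hH]

theorem selMat_transpose_mulVec {s : ℕ} (S : Finset (Fin s)) (w : Fin s → ℝ)
    (hw : ∀ i ∉ S, w i = 0) : (selMat S)ᵀ *ᵥ (fun i : S => w i) = w := by
  ext i
  simp only [selMat, mulVec, dotProduct, transpose_apply, submatrix_apply, id, one_apply]
  rw [Finset.sum_coe_sort S (fun j => (if j = i then (1 : ℝ) else 0) * w j)]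
  by_cases hi : i ∈ S
  · simp [hi]
  · simp [hi, hw i hi]

theorem selMat_mulVec {s : ℕ} (S : Finset (Fin s)) (w : Fin s → ℝ) :
    selMat S *ᵥ w = fun i : S => w i := by
  ext i
  simp [selMat, mulVec, dotProduct, one_apply]

theorem sigMat_mulVec {s : ℕ} (z w : Fin s → ℝ) :
    sigMat z *ᵥ w = fun i => ((SignType.sign (z i) : SignType) : ℝ) * w i := by
  ext i
  simp [sigMat, mulVec_diagonal]

/-- Components with vanishing signature are already removed by `Σ`. -/
theorem selMat_mul_sigMat_mulVec {s : ℕ} (z w : Fin s → ℝ) :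
    ((selMat (activeSwitch z)ᶜ)ᵀ * selMat (activeSwitch z)ᶜ * sigMat z) *ᵥ w = sigMat z *ᵥ w := by
  rw [← mulVec_mulVec, ← mulVec_mulVec, selMat_mulVec, selMat_transpose_mulVec]
  intro i hi
  have : z i = 0 := by simpa [activeSwitch] using hi
  simp [sigMat_mulVec, this]

/-! ### The Lagrangian and the switching equation at the reference point -/

namespace NLP

variable {d : ℕ∞} {n m₁ m₂ s : ℕ} {P : NLP d n m₁ m₂ s}
  {t : Fin n → ℝ} {z : Fin s → ℝ} {l : Multiplier m₁ m₂ s}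

theorem prod_mem_nhds (ht : t ∈ P.Dt) (hz : cabs z ∈ P.Dz) :
    P.Dt ×ˢ P.Dz ∈ 𝓝 (t, cabs z) :=
  (P.isOpen_Dt.prod P.isOpen_Dz).mem_nhds ⟨ht, hz⟩

theorem contDiffAt_lagrangian (hd : 2 ≤ d) (ht : t ∈ P.Dt) (hz : cabs z ∈ P.Dz) :
    ContDiffAt ℝ 2 (P.lagrangian z l) (t, cabs z) := by
  have hd' : (2 : WithTop ℕ∞) ≤ (d : WithTop ℕ∞) := WithTop.coe_le_coe.2 hd
  have hm := P.prod_mem_nhds ht hz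
  have hf : ContDiffAt ℝ 2 (fun p : (Fin n → ℝ) × (Fin s → ℝ) => P.f p.1) (t, cabs z) :=
    ((P.contDiffOn_f.contDiffAt (P.isOpen_Dt.mem_nhds ht)).of_le hd').comp (t, cabs z)
      contDiffAt_fst
  have hE := (P.contDiffOn_cE.contDiffAt hm).of_le hd'
  have hI := (P.contDiffOn_cI.contDiffAt hm).of_le hd'
  have hZ := (P.contDiffOn_cZ.contDiffAt hm).of_le hd'
  rw [contDiffAt_pi] at hE hI hZ
  unfold lagrangian
  simp only [dotProduct, mulVec, Pi.sub_apply]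
  refine ((hf.add (ContDiffAt.sum fun i _ => contDiffAt_const.mul (hE i))).sub
    (ContDiffAt.sum fun i _ => contDiffAt_const.mul (hI i))).add
    (ContDiffAt.sum fun i _ => contDiffAt_const.mul ((hZ i).sub
      (ContDiffAt.sum fun j _ => contDiffAt_const.mul ?_)))
  exact (contDiff_apply ℝ ℝ j).contDiffAt.comp (t, cabs z) contDiffAt_snd

/-- Right multiplication by the diagonal Σ keeps ∂₂c_Z strictly lower triangular, so the matrix is
lower triangular with unit diagonal. -/
theorem isUnit_det_one_sub (ht : t ∈ P.Dt) (hz : cabs z ∈ P.Dz) :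
    IsUnit (1 - jac₂ P.cZ t (cabs z) * sigMat z).det := by
  -- Only |z| is known to lie in `Dz`, so the triangularity axiom is applied at |z|, whose modulus
  -- is again |z|.
  have habs : cabs (cabs z) = cabs z := by
    ext i
    simp [cabs]
  have h0 : ∀ i j : Fin s, i ≤ j → jac₂ P.cZ t (cabs z) i j = 0 := fun i j hij => by
    simpa only [habs] using P.strictLower t ht _ hz i j hij
  rw [det_of_isLowerTriangular]
  · simp [sigMat, mul_diagonal, h0]
  · intro i j hij
    have hij' : i < j := hij
    simp [sigMat, mul_diagonal, h0 i j hij'.le, hij'.ne]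

/-- The linearized switching equation determines the switching direction. -/
theorem eq_jacz_mulVec (ht : t ∈ P.Dt) (hz : cabs z ∈ P.Dz) {τ : Fin n → ℝ} {ζ : Fin s → ℝ}
    (h : ζ = jac₁ P.cZ t (cabs z) *ᵥ τ + jac₂ P.cZ t (cabs z) *ᵥ (sigMat z *ᵥ ζ)) :
    ζ = P.jacz t z *ᵥ τ := by
  have h1 : (1 - jac₂ P.cZ t (cabs z) * sigMat z) *ᵥ ζ = jac₁ P.cZ t (cabs z) *ᵥ τ := by
    rw [sub_mulVec, one_mulVec, ← mulVec_mulVec, sub_eq_iff_eq_add]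
    exact h
  rw [jacz, ← mulVec_mulVec, ← h1, mulVec_mulVec, nonsing_inv_mul _ (isUnit_det_one_sub ht hz),
    one_mulVec]

theorem grad_dotProduct (f : (Fin n → ℝ) → ℝ) (t τ : Fin n → ℝ) :
    grad f t ⬝ᵥ τ = fderiv ℝ f t τ := by
  have h := LinearMap.pi_apply_eq_sum_univ ((fderiv ℝ f t) : (Fin n → ℝ) →ₗ[ℝ] ℝ) τ
  have e1 : ∀ i : Fin n, (fun j => if i = j then (1 : ℝ) else 0) = Pi.single i 1 := by
    intro i
    ext j
    simp [Pi.single_apply, eq_comm]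
  simp only [e1, ContinuousLinearMap.coe_coe, smul_eq_mul] at h
  rw [h]
  simp only [grad, dotProduct, mul_comm]

/-- At a kink stationary point the derivative of the Lagrangian only sees the active switching
directions. -/
theorem fderiv_lagrangian (hstat : P.IsKinkStationary t z l)
    (v : (Fin n → ℝ) × (Fin s → ℝ)) :
    fderiv ℝ (P.lagrangian z l) (t, cabs z) v
      = ∑ i, if z i = 0 then P.normalVec t z l i * v.2 i else 0 := by
  obtain ⟨ht, hz, -⟩ := hstat.feas
  have hm := P.prod_mem_nhds ht hz
  have hd' : (d : WithTop ℕ∞) ≠ 0 := by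
    have := P.one_le_d
    intro h0
    have h1 : d = 0 := by exact_mod_cast h0
    simp [h1] at this
  have hf := ((P.contDiffOn_f.contDiffAt (P.isOpen_Dt.mem_nhds ht)).differentiableAt hd')
  have hE := (P.contDiffOn_cE.contDiffAt hm).differentiableAt hd'
  have hI := (P.contDiffOn_cI.contDiffAt hm).differentiableAt hd'
  have hZ := (P.contDiffOn_cZ.contDiffAt hm).differentiableAt hd'
  have hdot : ∀ {m : ℕ} (a : Fin m → ℝ) {F : (Fin n → ℝ) × (Fin s → ℝ) → (Fin m → ℝ)}
      (F' : (Fin n → ℝ) × (Fin s → ℝ) →L[ℝ] (Fin m → ℝ)), HasFDerivAt F F' (t, cabs z) →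
      HasFDerivAt (fun p => a ⬝ᵥ F p)
        ((LinearMap.toContinuousLinearMap (dotProductBilin ℝ ℝ a)).comp F') (t, cabs z) :=
    fun a F F' hF => (LinearMap.toContinuousLinearMap (dotProductBilin ℝ ℝ a)).hasFDerivAt.comp
      _ hF
  set M := (selMat (activeSwitch z)ᶜ)ᵀ * selMat (activeSwitch z)ᶜ * sigMat z with hM
  have hMv : M *ᵥ v.2 = sigMat z *ᵥ v.2 := selMat_mul_sigMat_mulVec z v.2
  have hMd : HasFDerivAt (fun p : (Fin n → ℝ) × (Fin s → ℝ) => M *ᵥ p.2)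
      ((LinearMap.toContinuousLinearMap (mulVecLin M)).comp
        (ContinuousLinearMap.snd ℝ _ _)) (t, cabs z) :=
    (LinearMap.toContinuousLinearMap (mulVecLin M)).hasFDerivAt.comp _ hasFDerivAt_snd
  have hfd : HasFDerivAt (fun p : (Fin n → ℝ) × (Fin s → ℝ) => P.f p.1)
      ((fderiv ℝ P.f t).comp (ContinuousLinearMap.fst ℝ _ _)) (t, cabs z) :=
    hf.hasFDerivAt.comp (t, cabs z) hasFDerivAt_fst
  have hL : HasFDerivAt (P.lagrangian z l) _ (t, cabs z) :=
    ((hfd.add (hdot l.E _ hE.hasFDerivAt)).sub (hdot l.I _ hI.hasFDerivAt)).add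
      (hdot l.Z _ (hZ.hasFDerivAt.sub hMd))
  rw [hL.fderiv]
  have e : ∀ {m : ℕ} (a : Fin m → ℝ) (J₁ : Matrix (Fin m) (Fin n) ℝ) (J₂ : Matrix (Fin m) (Fin s) ℝ),
      a ⬝ᵥ (J₁ *ᵥ v.1 + J₂ *ᵥ v.2) = (a ᵥ* J₁) ⬝ᵥ v.1 + (a ᵥ* J₂) ⬝ᵥ v.2 := by
    intro m a J₁ J₂
    rw [dotProduct_add, dotProduct_mulVec, dotProduct_mulVec]
  have hs := congrArg (· ⬝ᵥ v.1) hstat.stat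
  simp only [sub_dotProduct, add_dotProduct, zero_dotProduct, grad_dotProduct] at hs
  -- For inactive i, g_i = (λ_Z)_i σ_i cancels the Σ-term; for active i, σ_i = 0 and g_i survives.
  have hn : P.normalVec t z l ⬝ᵥ v.2 - l.Z ⬝ᵥ (sigMat z *ᵥ v.2)
      = ∑ i, if z i = 0 then P.normalVec t z l i * v.2 i else 0 := by
    rw [sigMat_mulVec, dotProduct, dotProduct, ← Finset.sum_sub_distrib]
    refine Finset.sum_congr rfl fun i _ => ?_
    split_ifs with hi
    · simp [hi]
    · rw [hstat.inactive i (by simpa [activeSwitch] using hi)]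
      ring
  rw [← hn, normalVec, sub_eq_add_neg]
  simp only [sub_dotProduct, add_dotProduct]
  simp [jac_mulVec_add hE, jac_mulVec_add hI, jac_mulVec_add hZ, e, hMv]
  linarith

/-- The Lagrangian on feasible points with the same inactive signs as the reference point. -/
theorem lagrangian_of_feasible {p : (Fin n → ℝ) × (Fin s → ℝ)} (hp : p ∈ P.feasible)
    (hsign : ∀ i, z i ≠ 0 → SignType.sign (p.2 i) = SignType.sign (z i)) :
    P.lagrangian z l (p.1, cabs p.2) = P.f p.1 - l.I ⬝ᵥ P.cI (p.1, cabs p.2)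
      + ∑ i, if z i = 0 then l.Z i * p.2 i else 0 := by
  obtain ⟨-, -, hE, -, hZ⟩ := hp
  rw [lagrangian, hE, sub_eq_zero.1 hZ, dotProduct_zero, add_zero, selMat_mul_sigMat_mulVec,
    sigMat_mulVec]
  congr 1
  refine Finset.sum_congr rfl fun i _ => ?_
  split_ifs with hi
  · simp [hi]
  -- With a frozen sign, σ_i |z_i| = z_i, so the switching residual vanishes.
  · simp only [Pi.sub_apply, cabs, ← hsign i hi]
    rw [sign_mul_abs, sub_self, mul_zero]

/-- The reduced Hessian condition as positivity of the second derivative on critical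
directions. -/
theorem hessian_pos {k : ℕ} {U : Matrix (Fin n) (Fin k) ℝ}
    (hU : SpansNullspace U (P.Jabs t z))
    (hpos : ((P.Uabs t z U).transpose * P.Habs t z l * P.Uabs t z U).PosDef)
    {τ : Fin n → ℝ} (hτ : P.Jabs t z *ᵥ τ = 0) (h0 : τ ≠ 0) :
    0 < fderiv ℝ (fderiv ℝ (P.lagrangian z l)) (t, cabs z)
      (τ, sigMat z *ᵥ (P.jacz t z *ᵥ τ)) (τ, sigMat z *ᵥ (P.jacz t z *ᵥ τ)) := by
  have hmem : τ ∈ LinearMap.range U.mulVecLin := by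
    rw [range_mulVecLin, hU]
    exact hτ
  obtain ⟨v, hv⟩ := hmem
  have hv' : U *ᵥ v = τ := hv
  have hv0 : v ≠ 0 := by
    rintro rfl
    exact h0 (by simp [← hv'])
  have key := hpos.dotProduct_mulVec_pos hv0
  set ω := sigMat z *ᵥ (P.jacz t z *ᵥ τ) with hω
  -- Σ annihilates the active components, so padding the αᶜ-part with zeros recovers the full vector
  -- ω.
  have hω0 : ∀ i ∉ (activeSwitch z)ᶜ, ω i = 0 := by
    intro i hi
    have : z i = 0 := by simpa [activeSwitch] using hi
    rw [hω, sigMat_mulVec]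
    simp [this]
  have hUv : P.Uabs t z U *ᵥ v
      = Sum.elim τ (fun i : ((activeSwitch z)ᶜ : Finset (Fin s)) => ω i) := by
    rw [Uabs, fromRows_mulVec, hv']
    congr 1
    ext i
    change ((sigMat z * P.jacz t z * U) *ᵥ v) i = ω i
    rw [← mulVec_mulVec, ← mulVec_mulVec, hv']
  rw [← dotProduct_blockHessian_mulVec]
  have hQ : (fromBlocks (1 : Matrix (Fin n) (Fin n) ℝ) 0 0 (selMat (activeSwitch z)ᶜ))ᵀ *ᵥ
      Sum.elim τ (fun i : ((activeSwitch z)ᶜ : Finset (Fin s)) => ω i) = Sum.elim τ ω := by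
    rw [fromBlocks_transpose, fromBlocks_mulVec]
    simp [selMat_transpose_mulVec _ ω hω0]
  refine key.trans_eq ?_
  rw [star_trivial, ← mulVec_mulVec, ← mulVec_mulVec, hUv, dotProduct_mulVec v,
    vecMul_transpose, hUv, Habs]
  rw [← mulVec_mulVec, ← mulVec_mulVec, hQ, dotProduct_mulVec (Sum.elim τ _),
    ← mulVec_transpose, hQ]

end NLP

/-! ### Limits of normalized feasible steps -/

theorem tendsto_scaled_sub {E F ι : Type*} [NormedAddCommGroup E] [NormedSpace ℝ E]
    [NormedAddCommGroup F] [NormedSpace ℝ F] {f : E → F} {x v : E}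
    (hf : DifferentiableAt ℝ f x) {l : Filter ι} {c : ι → ℝ} {y : ι → E}
    (hy : Tendsto y l (𝓝 x)) (hv : Tendsto (fun i => c i • (y i - x)) l (𝓝 v)) :
    Tendsto (fun i => c i • (f (y i) - f x)) l (𝓝 (fderiv ℝ f x v)) := by
  have h0 : Tendsto (fun i => y i - x) l (𝓝 0) := by simpa using hy.sub_const x
  have := (hasFDerivWithinAt_univ.2 hf.hasFDerivAt).lim h0 (by simp) hv
  simpa using this

theorem continuous_cabs {s : ℕ} : Continuous (cabs : (Fin s → ℝ) → (Fin s → ℝ)) :=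
  continuous_pi fun i => (continuous_apply i).abs

theorem eventually_sign_eq {n s : ℕ} (t : Fin n → ℝ) (z : Fin s → ℝ) :
    ∀ᶠ p : (Fin n → ℝ) × (Fin s → ℝ) in 𝓝 (t, z),
      ∀ i, z i ≠ 0 → SignType.sign (p.2 i) = SignType.sign (z i) := by
  rw [eventually_all]
  intro i
  by_cases hi : z i = 0
  · simp [hi]
  have h1 : Tendsto (fun p : (Fin n → ℝ) × (Fin s → ℝ) => SignType.sign (p.2 i)) (𝓝 (t, z))
      (𝓝 (SignType.sign (z i))) :=
    (continuousAt_sign_of_ne_zero hi).tendsto.comp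
      (((continuous_apply i).comp continuous_snd).tendsto (t, z))
  rw [nhds_discrete SignType, tendsto_pure] at h1
  exact h1.mono fun p hp _ => hp

namespace NLP

variable {d : ℕ∞} {n m₁ m₂ s : ℕ} {P : NLP d n m₁ m₂ s}
  {t : Fin n → ℝ} {z : Fin s → ℝ} {l : Multiplier m₁ m₂ s}

theorem lagrangian_self (hstat : P.IsKinkStationary t z l) :
    P.lagrangian z l (t, cabs z) = P.f t := by
  rw [lagrangian_of_feasible (p := (t, z)) hstat.feas fun _ _ => rfl, hstat.compl]
  simp +contextual

/-- The objective is bounded below by the second-order remainder of the Lagrangian plus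
nonnegative terms, one for each inequality and each active switching variable. -/
theorem objective_sub_eq (hstat : P.IsKinkStationary t z l)
    {p : (Fin n → ℝ) × (Fin s → ℝ)} (hp : p ∈ P.feasible)
    (hsign : ∀ i, z i ≠ 0 → SignType.sign (p.2 i) = SignType.sign (z i)) :
    P.f p.1 - P.f t = (P.lagrangian z l (p.1, cabs p.2) - P.lagrangian z l (t, cabs z)
        - fderiv ℝ (P.lagrangian z l) (t, cabs z) ((p.1, cabs p.2) - (t, cabs z)))
      + ∑ j, l.I j * P.cI (p.1, cabs p.2) j
      + ∑ i, if z i = 0 then P.normalVec t z l i * |p.2 i| - l.Z i * p.2 i else 0 := by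
  rw [fderiv_lagrangian hstat, lagrangian_self hstat, lagrangian_of_feasible hp hsign]
  have : ∀ i, (if z i = 0 then P.normalVec t z l i * |p.2 i| - l.Z i * p.2 i else 0)
      = (if z i = 0 then P.normalVec t z l i * ((p.1, cabs p.2) - (t, cabs z)).2 i else 0)
        - (if z i = 0 then l.Z i * p.2 i else 0) := by
    intro i
    split_ifs with hi
    · simp [cabs, hi]
    · simp
  rw [Finset.sum_congr rfl fun i _ => this i, Finset.sum_sub_distrib, dotProduct]
  ring

/-- If the strict local minimality fails, there is a unit direction of nonpositive curvature of
the Lagrangian which is critical for the linearized constraints. -/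
theorem exists_critical_direction (hd : 2 ≤ d) (hstat : P.IsKinkStationary t z l)
    (hcompl : P.StrictComplementarity t z l) (hgrowth : P.StrictNormalGrowth t z l)
    (hcon : ∃ᶠ p in 𝓝 (t, z), p ∈ P.feasible ∧ p ≠ (t, z) ∧ P.f p.1 ≤ P.f t) :
    ∃ (v : (Fin n → ℝ) × (Fin s → ℝ)) (ζ : Fin s → ℝ), v ≠ 0 ∧
      fderiv ℝ (fderiv ℝ (P.lagrangian z l)) (t, cabs z) v v ≤ 0 ∧
      fderiv ℝ P.cE (t, cabs z) v = 0 ∧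
      (∀ j ∈ P.activeIneq t z, fderiv ℝ P.cI (t, cabs z) v j = 0) ∧
      fderiv ℝ P.cZ (t, cabs z) v = ζ ∧
      v.2 = sigMat z *ᵥ ζ ∧ ∀ i ∈ activeSwitch z, ζ i = 0 := by
  obtain ⟨ht, hz, hE0, -, hZ0⟩ := hstat.feas
  simp only at ht hz hE0 hZ0
  have hm := P.prod_mem_nhds ht hz
  have hd' : (d : WithTop ℕ∞) ≠ 0 := by
    rintro h0
    have h1 : d = 0 := by exact_mod_cast h0
    simp [h1] at hd
  have hE := (P.contDiffOn_cE.contDiffAt hm).differentiableAt hd'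
  have hI := (P.contDiffOn_cI.contDiffAt hm).differentiableAt hd'
  have hZ := (P.contDiffOn_cZ.contDiffAt hm).differentiableAt hd'
  set S := {p | p ∈ P.feasible ∧ p ≠ (t, z) ∧ P.f p.1 ≤ P.f t} with hS
  have : (𝓝 (t, z) ⊓ 𝓟 S).NeBot := frequently_mem_iff_neBot.1 hcon
  -- An ultrafilter concentrated on the bad points replaces successive extraction of subsequences.
  set 𝒰 : Ultrafilter ((Fin n → ℝ) × (Fin s → ℝ)) := Ultrafilter.of (𝓝 (t, z) ⊓ 𝓟 S)
  have h𝒰 : (𝒰 : Filter _) ≤ 𝓝 (t, z) := (Ultrafilter.of_le _).trans inf_le_left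
  have hbad : ∀ᶠ p in (𝒰 : Filter _), p ∈ S :=
    ((Ultrafilter.of_le _).trans inf_le_right) (mem_principal_self S)
  have hsign : ∀ᶠ p : (Fin n → ℝ) × (Fin s → ℝ) in (𝒰 : Filter _),
      ∀ i, z i ≠ 0 → SignType.sign (p.2 i) = SignType.sign (z i) :=
    (eventually_sign_eq t z).filter_mono h𝒰
  set x₀ : (Fin n → ℝ) × (Fin s → ℝ) := (t, cabs z) with hx₀
  set φ : (Fin n → ℝ) × (Fin s → ℝ) → (Fin n → ℝ) × (Fin s → ℝ) :=
    fun p => (p.1, cabs p.2) with hφ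
  have hφt : Tendsto φ (𝒰 : Filter _) (𝓝 x₀) :=
    ((continuous_fst.prodMk (continuous_cabs.comp continuous_snd)).tendsto (t, z)).mono_left h𝒰
  have hδ0 : Tendsto (fun p => φ p - x₀) (𝒰 : Filter _) (𝓝 0) := by
    simpa using hφt.sub_const x₀
  set c : (Fin n → ℝ) × (Fin s → ℝ) → ℝ := fun p => ‖φ p - x₀‖⁻¹ with hc
  have hc0 : ∀ p, 0 ≤ c p := fun p => inv_nonneg.2 (norm_nonneg _)
  -- Passing to |z| loses no feasible point: z is recovered as c_Z(t, |z|).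
  have hne : ∀ p ∈ S, φ p - x₀ ≠ 0 := by
    rintro p ⟨hp, hpne, -⟩ h0
    have h1 : φ p = x₀ := sub_eq_zero.1 h0
    have h3 : p.1 = t := congrArg Prod.fst h1
    refine hpne (Prod.ext h3 ?_)
    have h2 : P.cZ (φ p) = p.2 := sub_eq_zero.1 hp.2.2.2.2
    rw [← h2, h1]
    exact sub_eq_zero.1 hZ0
  obtain ⟨v, hv1, hv⟩ := (isCompact_sphere (0 : (Fin n → ℝ) × (Fin s → ℝ)) 1).ultrafilter_le_nhds
    (𝒰.map fun p => c p • (φ p - x₀)) (by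
      rw [le_principal_iff, Ultrafilter.coe_map, mem_map]
      filter_upwards [hbad] with p hp
      have := norm_ne_zero_iff.2 (hne p hp)
      simp [hc, norm_smul, this])
  replace hv : Tendsto (fun p => c p • (φ p - x₀)) (𝒰 : Filter _) (𝓝 v) := hv
  have hv0 : v ≠ 0 := by
    rintro rfl
    simp at hv1
  have hEv := tendsto_scaled_sub hE hφt hv
  have hIv := tendsto_scaled_sub hI hφt hv
  have hZv := tendsto_scaled_sub hZ hφt hv
  set ζ := fderiv ℝ P.cZ x₀ v with hζ
  have hζt : Tendsto (fun p => c p • (p.2 - z)) (𝒰 : Filter _) (𝓝 ζ) := by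
    refine hZv.congr' ?_
    filter_upwards [hbad] with p hp
    rw [sub_eq_zero.1 hp.1.2.2.2.2, sub_eq_zero.1 hZ0]
  have hζi : ∀ i, Tendsto (fun p => c p * (p.2 i - z i)) (𝒰 : Filter _) (𝓝 (ζ i)) := fun i =>
    (tendsto_pi_nhds.1 hζt) i
  have hωi : ∀ i, Tendsto (fun p => c p * (|p.2 i| - |z i|)) (𝒰 : Filter _) (𝓝 (v.2 i)) :=
    fun i => (tendsto_pi_nhds.1 ((continuous_snd.tendsto v).comp hv)) i
  set R : (Fin n → ℝ) × (Fin s → ℝ) → ℝ := fun p =>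
    P.lagrangian z l (φ p) - P.lagrangian z l x₀
      - fderiv ℝ (P.lagrangian z l) x₀ (φ p - x₀) with hR
  have hRt : Tendsto (fun p => c p ^ 2 * R p) (𝒰 : Filter _)
      (𝓝 ((1 / 2) * fderiv ℝ (fderiv ℝ (P.lagrangian z l)) x₀ v v)) := by
    have := tendsto_second_order (contDiffAt_lagrangian (l := l) hd ht hz) hδ0 hv
    refine this.congr fun p => ?_
    rw [← hx₀, add_sub_cancel]
  -- Since c is the inverse step length, c R = ‖step‖ · (c² R), a null factor times a convergent
  -- one.
  have hcR : Tendsto (fun p => c p * -R p) (𝒰 : Filter _) (𝓝 0) := by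
    have h1 := (hδ0.norm.mul hRt).neg
    rw [norm_zero, zero_mul, neg_zero] at h1
    refine h1.congr' ?_
    filter_upwards [hbad] with p hp
    have := norm_ne_zero_iff.2 (hne p hp)
    simp only [hc]
    field_simp
  set A : (Fin n → ℝ) × (Fin s → ℝ) → Fin m₂ → ℝ := fun p j => l.I j * P.cI (φ p) j with hA
  set B : (Fin n → ℝ) × (Fin s → ℝ) → Fin s → ℝ := fun p i =>
    if z i = 0 then P.normalVec t z l i * |p.2 i| - l.Z i * p.2 i else 0 with hB
  have hA0 : ∀ p ∈ S, ∀ j, 0 ≤ A p j := fun p hp j => mul_nonneg (hstat.nonneg j) (hp.1.2.2.2.1 j)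
  have hB0 : ∀ p, ∀ i, 0 ≤ B p i := by
    intro p i
    simp only [hB]
    split_ifs with hi
    · have h1 := hstat.active i (by simpa [activeSwitch] using hi)
      have h2 := le_abs_self (l.Z i * p.2 i)
      rw [abs_mul] at h2
      have := mul_le_mul_of_nonneg_right h1 (abs_nonneg (p.2 i))
      linarith
    · exact le_rfl
  have hsum : ∀ᶠ p in (𝒰 : Filter _), R p + ∑ j, A p j + ∑ i, B p i ≤ 0 := by
    filter_upwards [hbad, hsign] with p hp hs
    have h1 := objective_sub_eq hstat hp.1 hs
    have h2 := hp.2.2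
    change _ = R p + ∑ j, A p j + ∑ i, B p i at h1
    linarith
  have hsA : ∀ p ∈ S, 0 ≤ ∑ j, A p j := fun p hp => Finset.sum_nonneg fun j _ => hA0 p hp j
  have hsB : ∀ p, 0 ≤ ∑ i, B p i := fun p => Finset.sum_nonneg fun i _ => hB0 p i
  have hAlim : ∀ j, Tendsto (fun p => c p * A p j) (𝒰 : Filter _) (𝓝 0) := by
    intro j
    refine tendsto_of_tendsto_of_tendsto_of_le_of_le' tendsto_const_nhds hcR ?_ ?_
    · filter_upwards [hbad] with p hp using mul_nonneg (hc0 p) (hA0 p hp j)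
    · filter_upwards [hbad, hsum] with p hp hs
      have := Finset.single_le_sum (fun k _ => hA0 p hp k) (Finset.mem_univ j)
      exact mul_le_mul_of_nonneg_left (by linarith [hsB p]) (hc0 p)
  have hBlim : ∀ i, Tendsto (fun p => c p * B p i) (𝒰 : Filter _) (𝓝 0) := by
    intro i
    refine tendsto_of_tendsto_of_tendsto_of_le_of_le' tendsto_const_nhds hcR ?_ ?_
    · exact Eventually.of_forall fun p => mul_nonneg (hc0 p) (hB0 p i)
    · filter_upwards [hbad, hsum] with p hp hs
      have := Finset.single_le_sum (fun k _ => hB0 p k) (Finset.mem_univ i)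
      exact mul_le_mul_of_nonneg_left (by linarith [hsA p hp]) (hc0 p)
  -- The scaled normal term converges both to g_i |ζ_i| - (λ_Z)_i ζ_i and to 0; strict growth makes
  -- the former positive unless ζ_i = 0.
  have hζ0 : ∀ i, z i = 0 → ζ i = 0 := by
    intro i hi
    have h1 : Tendsto (fun p => c p * B p i) (𝒰 : Filter _)
        (𝓝 (P.normalVec t z l i * |ζ i| - l.Z i * ζ i)) := by
      refine (((hζi i).abs.const_mul (P.normalVec t z l i)).sub
        ((hζi i).const_mul (l.Z i))).congr fun p => ?_
      simp only [hB, hi, if_true, sub_zero, abs_mul, abs_of_nonneg (hc0 p)]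
      ring
    have h2 := tendsto_nhds_unique h1 (hBlim i)
    have h3 := hgrowth i (by simpa [activeSwitch] using hi)
    have h4 := le_abs_self (l.Z i * ζ i)
    rw [abs_mul] at h4
    by_contra hne
    have := mul_lt_mul_of_pos_right h3 (abs_pos.2 hne)
    linarith
  refine ⟨v, ζ, hv0, ?_, ?_, ?_, rfl, ?_, fun i hi => hζ0 i (by simpa [activeSwitch] using hi)⟩
  · have h1 : (1 / 2) * fderiv ℝ (fderiv ℝ (P.lagrangian z l)) x₀ v v ≤ 0 := by
      refine le_of_tendsto hRt ?_
      filter_upwards [hbad, hsum] with p hp hs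
      exact mul_nonpos_of_nonneg_of_nonpos (sq_nonneg _) (by linarith [hsA p hp, hsB p])
    linarith
  · refine tendsto_nhds_unique hEv (tendsto_const_nhds.congr' ?_)
    filter_upwards [hbad] with p hp
    have : P.cE (φ p) = 0 := hp.1.2.2.1
    rw [this, hE0, sub_zero, smul_zero]
  · intro j hj
    have hj0 : P.cI x₀ j = 0 := by simpa [activeIneq] using hj
    have h1 : Tendsto (fun p => c p * A p j) (𝒰 : Filter _)
        (𝓝 (l.I j * fderiv ℝ P.cI x₀ v j)) := by
      refine (((tendsto_pi_nhds.1 hIv) j).const_mul (l.I j)).congr fun p => ?_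
      simp only [Pi.smul_apply, Pi.sub_apply, smul_eq_mul, hj0, sub_zero, hA]
      ring
    exact (mul_eq_zero.1 (tendsto_nhds_unique h1 (hAlim j))).resolve_left (hcompl j hj).ne'
  · rw [sigMat_mulVec]
    ext i
    -- For active i, the scaled |z_i| tends to |ζ_i| = 0, matching σ_i = 0. For inactive i, the
    -- frozen sign makes the modulus linear.
    by_cases hi : z i = 0
    · have h1 := (hζi i).abs
      rw [hζ0 i hi, abs_zero] at h1
      simp only [hi, sign_zero, SignType.coe_zero, zero_mul]
      refine tendsto_nhds_unique (hωi i) (h1.congr fun p => ?_)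
      simp [hi, abs_mul, abs_of_nonneg (hc0 p)]
    · refine tendsto_nhds_unique (hωi i)
        (((hζi i).const_mul ((SignType.sign (z i) : SignType) : ℝ)).congr' ?_)
      filter_upwards [hsign] with p hp
      rw [← sign_mul_self (p.2 i), ← sign_mul_self (z i), hp i hi]
      ring

end NLP

end AbsNormal

theorem mainTheorem11 {d : ℕ∞} (hd : 2 ≤ d) {n m₁ m₂ s : ℕ}
    (P : AbsNormal.NLP d n m₁ m₂ s)
    (t : Fin n → ℝ) (z : Fin s → ℝ) (l : AbsNormal.Multiplier m₁ m₂ s)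
    (hstat : P.IsKinkStationary t z l)
    (hcompl : P.StrictComplementarity t z l)
    (hgrowth : P.StrictNormalGrowth t z l)
    (hlikq : P.LIKQ t z)
    {k : ℕ} (U : Matrix (Fin n) (Fin k) ℝ)
    (hU : AbsNormal.SpansNullspace U (P.Jabs t z))
    (hpos : ((P.Uabs t z U).transpose * P.Habs t z l * P.Uabs t z U).PosDef) :
    P.IsStrictLocalMinimizer t z := by
  refine ⟨hstat.feas, ?_⟩
  by_contra hcon
  have hcon' : ∃ᶠ p in 𝓝 (t, z), p ∈ P.feasible ∧ p ≠ (t, z) ∧ P.f p.1 ≤ P.f t := by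
    refine (Filter.not_eventually.1 hcon).mono fun p hp => ?_
    push Not at hp
    exact hp
  obtain ⟨⟨τ, ω⟩, ζ, hv0, hH, hE, hI, hZ, hω, hζ⟩ :=
    AbsNormal.NLP.exists_critical_direction hd hstat hcompl hgrowth hcon'
  obtain ⟨ht, hz, -⟩ := hstat.feas
  simp only at ht hz hω
  have hm := P.prod_mem_nhds ht hz
  have hd' : (d : WithTop ℕ∞) ≠ 0 := by
    rintro h0
    have h1 : d = 0 := by exact_mod_cast h0
    simp [h1] at hd
  subst hω
  rw [AbsNormal.jac_mulVec_add ((P.contDiffOn_cE.contDiffAt hm).differentiableAt hd')] at hE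
  rw [AbsNormal.jac_mulVec_add ((P.contDiffOn_cI.contDiffAt hm).differentiableAt hd')] at hI
  rw [AbsNormal.jac_mulVec_add ((P.contDiffOn_cZ.contDiffAt hm).differentiableAt hd')] at hZ
  have hj : ζ = P.jacz t z *ᵥ τ := AbsNormal.NLP.eq_jacz_mulVec ht hz hZ.symm
  subst hj
  -- Both components of the direction are linear in τ, so τ = 0 would make the direction zero.
  have hτ0 : τ ≠ 0 := by
    rintro rfl
    simp at hv0
  have hker : P.Jabs t z *ᵥ τ = 0 := by
    rw [AbsNormal.NLP.Jabs, fromRows_mulVec, fromRows_mulVec]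
    ext (i | i | i)
    · simpa [AbsNormal.NLP.JE, add_mulVec, ← mulVec_mulVec] using congrFun hE i
    · change ((_ + _) *ᵥ τ) i.1 = 0
      simpa [add_mulVec, ← mulVec_mulVec] using hI i.1 i.2
    · exact hζ i.1 i.2
  exact absurd (AbsNormal.NLP.hessian_pos hU hpos hker hτ0) (not_lt.2 hH)
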